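/- Let $n\ge 0$ and $m>n^2$ be integers. Let $\operatorname{Sing}_{n,m}$ be the set of all $m$-tuples $(A_1,\dots,A_m)$ of complex $n\times n$ matrices such that $\sum_{k=1}^m\lambda_kA_k$ is singular for all $\lambda\in\mathbb{Q}^m$, and let $I(\operatorname{Sing}_{n,m})\subseteq\mathbb{C}[X^{(1)},\dots,X^{(m)}]$ be its vanishing ideal, where $X^{(k)}=(x^{(k)}_{ij})_{1\le i,j\le n}$ are matrices of independent variables. View $\mathbb{C}[X^{(1)},\dots,X^{(m')}]$ as a subring of $\mathbb{C}[X^{(1)},\dots,X^{(m)}]$ for $m'\le m$. Let $G=\operatorname{GL}_m(\mathbb{C})\times\operatorname{GL}_n(\mathbb{C})\times\operatorname{GL}_n(\mathbb{C})$ act on $\mathbb{C}[X^{(1)},\dots,X^{(m)}]=\bigoplus_d S^d(\mathbb{C}^m\otimes\mathbb{C}^n\otimes\mathbb{C}^n)$ by algebra automorphisms, where the variable $x^{(k)}_{ij}$ is identified with $e_k\otimes e_i\otimes e_j$ and $(U,V,W)$ sends it to $Ue_k\otimes Ve_i\otimes We_j$. Let $H$ be either $G$ or its factor $\operatorname{GL}_m(\mathbb{C})$.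 A highest weight vector for $H$ is a nonzero vector on which the diagonal torus of $H$ acts through an integral weight and which is fixed by all elements of $H$ that are upper triangular with ones on the diagonal (in each factor). Then every irreducible $H$-subrepresentation $V$ of $\mathbb{C}[X^{(1)},\dots,X^{(m)}]$ contained in $I(\operatorname{Sing}_{n,m})$ contains a highest weight vector for $H$, and every highest weight vector $f\in V$ lies in $I(\operatorname{Sing}_{n,n^2})$; in particular $f$ involves only the variables of $X^{(1)},\dots,X^{(n^2)}$. -/

import Mathlib

open Matrix

/-- Index set of the variables `x_{ij}^{(k)}`, ordered as `(k, i, j)`; equivalently, of the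
coordinates on `ℂ^m ⊗ ℂ^n ⊗ ℂ^n`. -/
abbrev TensorIndex (m n : ℕ) : Type := Fin m × Fin n × Fin n

/-- The polynomial ring `ℂ[X^{(1)}, …, X^{(m)}]` in `m` generic `n × n` matrices. -/
abbrev TensorPoly (m n : ℕ) : Type := MvPolynomial (TensorIndex m n) ℂ

/-- The `k`-th matrix of the matrix tuple given by the coordinates `A`. -/
def slice {m n : ℕ} (A : TensorIndex m n → ℂ) (k : Fin m) : Matrix (Fin n) (Fin n) ℂ :=
  Matrix.of fun i j => A (k, i, j)

/-- The variety `Sing_{n,m}`: all `m`-tuples of complex `n × n` matrices all of whose rational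
linear combinations are singular. -/
def Sing (n m : ℕ) : Set (TensorIndex m n → ℂ) :=
  {A | ∀ c : Fin m → ℚ, (∑ k, (c k : ℂ) • slice A k).det = 0}

/-- The vanishing ideal `I(Sing_{n,m})` in `ℂ[X^{(1)}, …, X^{(m)}]`. -/
noncomputable def singIdeal (n m : ℕ) : Ideal (TensorPoly m n) :=
  MvPolynomial.vanishingIdeal ℂ (Sing n m)

/-- The group `GL_m × GL_n × GL_n`. -/
abbrev TensorGroup (m n : ℕ) : Type := GL (Fin m) ℂ × GL (Fin n) ℂ × GL (Fin n) ℂ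

/-- The linear substitution by which `g = (U, V, W)` acts on polynomials: the variable
`x_{ij}^{(k)}`, seen as the basis vector `e_k ⊗ e_i ⊗ e_j` of `ℂ^m ⊗ ℂ^n ⊗ ℂ^n`, is sent to
`(U e_k) ⊗ (V e_i) ⊗ (W e_j)`. -/
noncomputable def tensorSubst {m n : ℕ} (g : TensorGroup m n) :
    TensorPoly m n →ₐ[ℂ] TensorPoly m n :=
  MvPolynomial.aeval fun p : TensorIndex m n =>
    ∑ q : TensorIndex m n,
      MvPolynomial.C (g.1.1 q.1 p.1 * g.2.1.1 q.2.1 p.2.1 * g.2.2.1 q.2.2 p.2.2) *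
        MvPolynomial.X q

lemma tensorSubst_X {m n : ℕ} (g : TensorGroup m n) (p : TensorIndex m n) :
    tensorSubst g (MvPolynomial.X p) = ∑ q : TensorIndex m n,
      MvPolynomial.C (g.1.1 q.1 p.1 * g.2.1.1 q.2.1 p.2.1 * g.2.2.1 q.2.2 p.2.2) *
        MvPolynomial.X q := by
  simp [tensorSubst]

lemma tensorSubst_one {m n : ℕ} :
    tensorSubst (1 : TensorGroup m n) = AlgHom.id ℂ (TensorPoly m n) := by
  apply MvPolynomial.algHom_ext
  intro p
  rw [tensorSubst_X, Finset.sum_eq_single p]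
  · simp
  · rintro ⟨k, i, j⟩ - hq
    obtain ⟨k', i', j'⟩ := p
    by_cases h1 : k = k' <;> by_cases h2 : i = i' <;> by_cases h3 : j = j' <;>
      simp_all
  · simp

lemma tensorSubst_mul {m n : ℕ} (g h : TensorGroup m n) :
    tensorSubst (g * h) = (tensorSubst g).comp (tensorSubst h) := by
  apply MvPolynomial.algHom_ext
  intro p
  simp only [AlgHom.comp_apply, tensorSubst_X, map_sum, map_mul, MvPolynomial.algHom_C,
    MvPolynomial.algebraMap_eq, Finset.mul_sum]
  rw [Finset.sum_comm]
  refine Finset.sum_congr rfl fun r _ => ?_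
  simp only [← mul_assoc, ← map_mul, ← Finset.sum_mul, ← map_sum]
  congr 2
  have key : ∀ (a : Fin m → ℂ) (b c : Fin n → ℂ),
      (∑ x, a x) * (∑ y, b y) * (∑ z, c z) =
        ∑ s : TensorIndex m n, a s.1 * b s.2.1 * c s.2.2 := by
    intro a b c
    simp only [Fintype.sum_prod_type, Finset.sum_mul, Finset.mul_sum]
    rw [Finset.sum_comm]
    refine (Finset.sum_congr rfl fun x _ => Finset.sum_comm).trans ?_
    rw [Finset.sum_comm]
  simp only [Prod.fst_mul, Prod.snd_mul, Units.val_mul, Matrix.mul_apply, key]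
  refine Finset.sum_congr rfl fun s _ => ?_
  ring

/-- The representation of `GL_m × GL_n × GL_n` on
`ℂ[X^{(1)}, …, X^{(m)}] = ⨁_d S^d(ℂ^m ⊗ ℂ^n ⊗ ℂ^n)`. -/
noncomputable def tensorRep (m n : ℕ) : Representation ℂ (TensorGroup m n) (TensorPoly m n) where
  toFun g := (tensorSubst g).toLinearMap
  map_one' := by rw [tensorSubst_one]; rfl
  map_mul' g h := by rw [tensorSubst_mul]; rfl

/-- The restriction of `tensorRep` to the factor `GL_m`. -/
noncomputable def tensorRepGLm (m n : ℕ) : Representation ℂ (GL (Fin m) ℂ) (TensorPoly m n) :=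
  (tensorRep m n).comp (MonoidHom.inl (GL (Fin m) ℂ) (GL (Fin n) ℂ × GL (Fin n) ℂ))

/-- The element of the maximal torus of `GL_r` with diagonal entries `t`. -/
def torusElem {r : ℕ} (t : Fin r → ℂˣ) : GL (Fin r) ℂ where
  val := Matrix.diagonal fun i => (t i : ℂ)
  inv := Matrix.diagonal fun i => ((t i)⁻¹ : ℂˣ)
  val_inv := by simp [Matrix.diagonal_mul_diagonal]
  inv_val := by simp [Matrix.diagonal_mul_diagonal]

/-- The character `t ↦ ∏ i, t_i ^ w_i` of the maximal torus of `GL_r`. -/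
def torusChar {r : ℕ} (w : Fin r → ℤ) (t : Fin r → ℂˣ) : ℂˣ := ∏ i, t i ^ w i

/-- `u` lies in the maximal unipotent subgroup: it is upper triangular with ones on the
diagonal. -/
def IsUpperUnipotent {r : ℕ} (u : GL (Fin r) ℂ) : Prop :=
  (∀ i j, j < i → u.1 i j = 0) ∧ ∀ i, u.1 i i = 1

/-- `f` is a highest weight vector of weight `w` for `GL_r` (with respect to the upper triangular
Borel subgroup): a nonzero weight vector of weight `w` that is fixed by the maximal unipotent
subgroup. -/
structure IsHighestWeightVector {r : ℕ} {M : Type*} [AddCommGroup M] [Module ℂ M]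
    (ρ : Representation ℂ (GL (Fin r) ℂ) M) (w : Fin r → ℤ) (f : M) : Prop where
  ne_zero : f ≠ 0
  weight : ∀ t : Fin r → ℂˣ, ρ (torusElem t) f = (torusChar w t : ℂ) • f
  unipotent : ∀ u : GL (Fin r) ℂ, IsUpperUnipotent u → ρ u f = f

/-- `f` is a highest weight vector of weight `(w₁, w₂, w₃)` for `GL_m × GL_n × GL_n` (with respect
to the product of the upper triangular Borel subgroups). -/
structure IsTensorHighestWeightVector {m n : ℕ} {M : Type*} [AddCommGroup M] [Module ℂ M]
    (ρ : Representation ℂ (TensorGroup m n) M) (w₁ : Fin m → ℤ) (w₂ w₃ : Fin n → ℤ) (f : M) :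
    Prop where
  ne_zero : f ≠ 0
  weight : ∀ (t₁ : Fin m → ℂˣ) (t₂ t₃ : Fin n → ℂˣ),
    ρ (torusElem t₁, torusElem t₂, torusElem t₃) f =
      ((torusChar w₁ t₁ * torusChar w₂ t₂ * torusChar w₃ t₃ : ℂˣ) : ℂ) • f
  unipotent : ∀ (u₁ : GL (Fin m) ℂ) (u₂ u₃ : GL (Fin n) ℂ),
    IsUpperUnipotent u₁ → IsUpperUnipotent u₂ → IsUpperUnipotent u₃ → ρ (u₁, u₂, u₃) f = f

/-- The inclusion `ℂ[X^{(1)}, …, X^{(m')}] ↪ ℂ[X^{(1)}, …, X^{(m)}]` for `m' ≤ m`. -/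
noncomputable def tensorIncl (n : ℕ) {m' m : ℕ} (h : m' ≤ m) :
    TensorPoly m' n →ₐ[ℂ] TensorPoly m n :=
  MvPolynomial.rename fun p => (Fin.castLE h p.1, p.2)

/-!
Order the variables by the weight `k + i + j` of `x_{ij}^{(k)}`. Upper unipotent substitutions
change polynomials only by terms of lower weight, so they fix pointwise the first nonzero step of
the weight filtration of a subrepresentation `V`. That step is stable under the torus, which acts
diagonally on monomials, so a vector of minimal support in it is a highest weight vector.

Conversely, let `f` be fixed by the upper unipotent matrices in `GL_m`. At a tuple of matrices
whose first `n²` members form a basis of the `n × n` matrices, such a unipotent subtracts from each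
later matrix its expansion in that basis, so `f` takes the same value after the later matrices are
replaced by zero. These tuples are Zariski-dense, so `f` involves only the first `n²` matrices; and
extending a tuple by zeros preserves singularity of all its rational combinations.
-/

section CommonEigenvector

variable {α R M : Type*} [CommRing R] [AddCommGroup M] [Module R M]

lemma repr_apply_of_diagonal (b : Module.Basis α R M) {A : Module.End R M} {χ : α → R}
    (hA : ∀ i, A (b i) = χ i • b i) (f : M) (i : α) : b.repr (A f) i = χ i * b.repr f i := by
  classical
  have h : b.coord i ∘ₗ A = χ i • b.coord i := b.ext fun j => by
    rcases eq_or_ne j i with rfl | hji <;> simp_all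
  exact LinearMap.congr_fun h f

-- A nonzero vector of minimal support in `V`: if `a` lies in its support, then `A f - χ a • f` has
-- strictly smaller support and hence vanishes.
theorem exists_common_eigenvector_of_diagonal (b : Module.Basis α R M) {V : Submodule R M}
    (hV : V ≠ ⊥) :
    ∃ f ∈ V, f ≠ 0 ∧ ∃ a, ∀ (A : Module.End R M) (χ : α → R),
      (∀ i, A (b i) = χ i • b i) → V ∈ A.invtSubmodule → A f = χ a • f := by
  obtain ⟨f, ⟨hfV, hf0⟩, hmin⟩ := exists_minimalFor_of_wellFoundedLT (fun f => f ∈ V ∧ f ≠ 0)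
    (fun f => (b.repr f).support) (V.exists_mem_ne_zero_of_ne_bot hV)
  obtain ⟨a, ha⟩ : (b.repr f).support.Nonempty := by simpa using hf0
  refine ⟨f, hfV, hf0, a, fun A χ hA hAV => sub_eq_zero.mp ?_⟩
  have hrepr (i : α) : b.repr (A f - χ a • f) i = (χ i - χ a) * b.repr f i := by
    simp [repr_apply_of_diagonal b hA, sub_mul]
  have hsupp : (b.repr (A f - χ a • f)).support ⊆ (b.repr f).support := fun i hi =>
    Finsupp.mem_support_iff.mpr
      (right_ne_zero_of_mul (hrepr i ▸ Finsupp.mem_support_iff.mp hi))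
  by_contra hne
  have hmem : A f - χ a • f ∈ V := sub_mem (hAV hfV) (V.smul_mem _ hfV)
  exact Finsupp.mem_support_iff.mp (hmin ⟨hmem, hne⟩ hsupp ha) (by rw [hrepr, sub_self, zero_mul])

end CommonEigenvector

section WeightFiltration

open MvPolynomial Finsupp

variable {σ R : Type*} [CommRing R] {w : σ → ℕ}

variable (R w) in
/-- The filtration of a polynomial ring by weight when `X p` has weight `w p`: step `L` consists of
the polynomials all of whose monomials have weight `< L`. An algebra endomorphism that changes each
variable only by terms of lower weight acts trivially on the associated graded pieces. -/
noncomputable def weightLT (L : ℕ) : Submodule R (MvPolynomial σ R) :=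
  restrictSupport R {s | weight w s < L}

lemma weightLT_zero : weightLT R w 0 = ⊥ := by
  simp [weightLT, restrictSupport_eq_span]

lemma weightLT_mono : Monotone (weightLT R w) := fun _ _ h =>
  restrictSupport_mono R fun _ hs => lt_of_lt_of_le hs h

lemma exists_mem_weightLT (f : MvPolynomial σ R) : ∃ L, f ∈ weightLT R w L :=
  ⟨f.support.sup (weight w) + 1, fun _ hs => Nat.lt_succ_of_le (Finset.le_sup (f := weight w) hs)⟩

lemma monomial_mem_weightLT (s : σ →₀ ℕ) (a : R) :
    monomial s a ∈ weightLT R w (weight w s + 1) :=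
  (monomial_mem_restrictSupport R).mpr (Or.inl (Nat.lt_succ_self _))

lemma mul_mem_weightLT {K L : ℕ} {f g : MvPolynomial σ R} (hf : f ∈ weightLT R w K)
    (hg : g ∈ weightLT R w (L + 1)) : f * g ∈ weightLT R w (K + L) := by
  have h := Submodule.mul_mem_mul hf hg
  rw [weightLT, weightLT, ← restrictSupport_add] at h
  refine restrictSupport_mono R ?_ h
  rintro _ ⟨a, ha, b, hb, rfl⟩
  simp only [Set.mem_ofPred_eq, map_add] at ha hb ⊢
  omega

lemma map_mul_sub_mem_weightLT (T : MvPolynomial σ R →ₐ[R] MvPolynomial σ R) {K L : ℕ}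
    {f g : MvPolynomial σ R} (hf : f ∈ weightLT R w (K + 1)) (hg : g ∈ weightLT R w (L + 1))
    (hTf : T f - f ∈ weightLT R w K) (hTg : T g - g ∈ weightLT R w L) :
    T (f * g) - f * g ∈ weightLT R w (K + L) := by
  have hTf' : T f ∈ weightLT R w (K + 1) := by
    simpa using add_mem (weightLT_mono K.le_succ hTf) hf
  have leibniz : T (f * g) - f * g = (T f - f) * g + (T g - g) * T f := by
    rw [map_mul]; ring
  rw [leibniz]
  exact add_mem (mul_mem_weightLT hTf hg) (K.add_comm L ▸ mul_mem_weightLT hTg hTf')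

lemma map_monomial_sub_mem_weightLT {T : MvPolynomial σ R →ₐ[R] MvPolynomial σ R}
    (hT : ∀ p, T (X p) - X p ∈ weightLT R w (w p)) (s : σ →₀ ℕ) :
    T (monomial s 1) - monomial s 1 ∈ weightLT R w (weight w s) := by
  induction s using Finsupp.induction_linear with
  | zero => simp
  | add s t hs ht =>
    have h := map_mul_sub_mem_weightLT T (monomial_mem_weightLT s 1) (monomial_mem_weightLT t 1)
      hs ht
    rwa [monomial_mul, mul_one, ← map_add] at h
  | single p e =>
    induction e with
    | zero => simp
    | succ e ih =>
      have hX : T (monomial (single p 1) 1) - monomial (single p 1) 1 ∈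
          weightLT R w (weight w (single p 1)) := by
        rw [weight_single, one_smul]
        exact hT p
      have h := map_mul_sub_mem_weightLT T (monomial_mem_weightLT _ 1) (monomial_mem_weightLT _ 1)
        ih hX
      rwa [monomial_mul, mul_one, ← map_add, ← Finsupp.single_add] at h

theorem map_sub_mem_weightLT {T : MvPolynomial σ R →ₐ[R] MvPolynomial σ R}
    (hT : ∀ p, T (X p) - X p ∈ weightLT R w (w p)) {L : ℕ} {f : MvPolynomial σ R}
    (hf : f ∈ weightLT R w (L + 1)) : T f - f ∈ weightLT R w L := by
  suffices h : weightLT R w (L + 1) ≤ (weightLT R w L).comap (T.toLinearMap - .id) from h hf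
  rw [weightLT, restrictSupport_eq_span, Submodule.span_le]
  rintro _ ⟨s, hs, rfl⟩
  exact weightLT_mono (Nat.lt_succ_iff.mp hs) (map_monomial_sub_mem_weightLT hT s)

lemma map_monomial_of_diagonal {T : MvPolynomial σ R →ₐ[R] MvPolynomial σ R} {c : σ → R}
    (hT : ∀ p, T (X p) = c p • X p) (s : σ →₀ ℕ) (a : R) :
    T (monomial s a) = (s.prod fun p e => c p ^ e) • monomial s a := by
  rw [monomial_eq, map_mul, algHom_C, map_finsuppProd]
  simp only [map_pow, hT, smul_eq_C_mul, algebraMap_eq]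
  simp only [map_pow, map_finsuppProd, mul_pow, prod_mul]
  ring

lemma weightLT_mem_invtSubmodule {T : MvPolynomial σ R →ₐ[R] MvPolynomial σ R} {c : σ → R}
    (hT : ∀ p, T (X p) = c p • X p) (L : ℕ) :
    weightLT R w L ∈ Module.End.invtSubmodule T.toLinearMap := by
  rw [Module.End.mem_invtSubmodule, weightLT, restrictSupport_eq_span, Submodule.span_le]
  rintro _ ⟨s, hs, rfl⟩
  rw [SetLike.mem_coe, Submodule.mem_comap, AlgHom.toLinearMap_apply,
    map_monomial_of_diagonal hT]
  exact Submodule.smul_mem _ _ (Submodule.subset_span ⟨s, hs, rfl⟩)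

theorem exists_weightVector_fixed (w : σ → ℕ) {V : Submodule R (MvPolynomial σ R)} (hV : V ≠ ⊥) :
    ∃ f ∈ V, f ≠ 0 ∧
      (∃ s : σ →₀ ℕ, ∀ (T : MvPolynomial σ R →ₐ[R] MvPolynomial σ R) (c : σ → R),
        (∀ p, T (X p) = c p • X p) → V ∈ Module.End.invtSubmodule T.toLinearMap →
          T f = (s.prod fun p e => c p ^ e) • f) ∧
      ∀ T : MvPolynomial σ R →ₐ[R] MvPolynomial σ R,
        (∀ p, T (X p) - X p ∈ weightLT R w (w p)) →
          V ∈ Module.End.invtSubmodule T.toLinearMap → T f = f := by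
  obtain ⟨L, hL, hL'⟩ : ∃ L, ¬ V ⊓ weightLT R w L ≠ ⊥ ∧ V ⊓ weightLT R w (L + 1) ≠ ⊥ := by
    refine Nat.exists_not_and_succ_of_not_zero_of_exists (by simp [weightLT_zero]) ?_
    obtain ⟨f, hfV, hf0⟩ := V.exists_mem_ne_zero_of_ne_bot hV
    obtain ⟨L, hL⟩ := exists_mem_weightLT (w := w) f
    exact ⟨L, (Submodule.ne_bot_iff _).mpr ⟨f, ⟨hfV, hL⟩, hf0⟩⟩
  obtain ⟨f, ⟨hfV, hfL⟩, hf0, s, hs⟩ :=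
    exists_common_eigenvector_of_diagonal (basisMonomials σ R) hL'
  refine ⟨f, hfV, hf0, ⟨s, fun T c hT hTV => ?_⟩, fun T hT hTV => ?_⟩
  · exact hs T.toLinearMap (fun s => s.prod fun p e => c p ^ e)
      (fun s => by simpa using map_monomial_of_diagonal hT s 1)
      (Sublattice.inf_mem hTV (weightLT_mem_invtSubmodule hT _))
  · have h : T f - f ∈ V ⊓ weightLT R w L := ⟨sub_mem (hTV hfV) hfV, map_sub_mem_weightLT hT hfL⟩
    rwa [not_not.mp hL, Submodule.mem_bot, sub_eq_zero] at h

end WeightFiltration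

section Shear

open MvPolynomial

variable {K : Type*} [Field K]

lemma eq_of_eval_eq_of_eval_ne_zero [Infinite K] {σ : Type*} {f g d : MvPolynomial σ K}
    (hd : d ≠ 0) (h : ∀ x, eval x d ≠ 0 → eval x f = eval x g) : f = g := by
  refine mul_left_cancel₀ hd (MvPolynomial.funext fun x => ?_)
  rw [map_mul, map_mul]
  rcases eq_or_ne (eval x d) 0 with hx | hx
  · rw [hx, zero_mul, zero_mul]
  · rw [h x hx]

theorem vars_subset_of_eval_indicator [Infinite K] {σ : Type*} {s : Set σ}
    {f d : MvPolynomial σ K} (hd : d ≠ 0)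
    (h : ∀ x, eval x d ≠ 0 → eval (s.indicator x) f = eval x f) : (f.vars : Set σ) ⊆ s := by
  classical
  let truncation (p : σ) : MvPolynomial σ K := if p ∈ s then X p else 0
  have hfix : bind₁ truncation f = f := by
    refine eq_of_eval_eq_of_eval_ne_zero hd fun x hx => ?_
    rw [← h x hx, ← aeval_eq_eval, ← aeval_eq_eval, aeval_bind₁]
    congr 2
    ext p
    by_cases hp : p ∈ s <;> simp [truncation, hp]
  intro p hp
  rw [← hfix] at hp
  obtain ⟨q, -, hq⟩ := Finset.mem_biUnion.mp (vars_bind₁ _ _ hp)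
  by_cases hqs : q ∈ s <;> simp_all [truncation]

variable {ι β : Type*} [Fintype β] {e : β → ι}

lemma exists_shear_eq_indicator [DecidableEq β] {A : Matrix ι β K}
    (hA : IsUnit (A.submatrix e id).det) :
    ∃ D : Matrix ι β K, (∀ b, D (e b) = 0) ∧
      (fun p : ι × β => (A - D * A.submatrix e id) p.1 p.2) =
        (Prod.fst ⁻¹' Set.range e).indicator fun p => A p.1 p.2 := by
  classical
  let D : Matrix ι β K := of fun k => if k ∈ Set.range e then 0 else (A * (A.submatrix e id)⁻¹) k
  refine ⟨D, fun b => if_pos ⟨b, rfl⟩, funext fun ⟨k, q⟩ => ?_⟩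
  by_cases hk : k ∈ Set.range e
  · have hDk : D k = 0 := if_pos hk
    rw [Set.indicator_of_mem (Set.mem_preimage.mpr hk), Matrix.sub_apply, mul_apply_eq_vecMul, hDk,
      zero_vecMul, Pi.zero_apply, sub_zero]
  · have hDk : D k = (A * (A.submatrix e id)⁻¹) k := if_neg hk
    rw [Set.indicator_of_notMem (mt Set.mem_preimage.mp hk), Matrix.sub_apply,
      mul_apply_eq_vecMul, hDk, ← mul_apply_eq_vecMul, nonsing_inv_mul_cancel_right _ _ hA,
      sub_self]

theorem fst_mem_range_of_mem_vars_of_shear_invariant [Infinite K] (he : Function.Injective e)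
    {f : MvPolynomial (ι × β) K}
    (hf : ∀ A D : Matrix ι β K, (∀ b, D (e b) = 0) →
      eval (fun p => (A - D * A.submatrix e id) p.1 p.2) f = eval (fun p => A p.1 p.2) f)
    {p : ι × β} (hp : p ∈ f.vars) : p.1 ∈ Set.range e := by
  classical
  let frame : MvPolynomial (ι × β) K := rename (Prod.map e id) (mvPolynomialX β β K).det
  have hframe : frame ≠ 0 :=
    (map_ne_zero_iff _ (rename_injective _ (he.prodMap Function.injective_id))).mpr
      (det_mvPolynomialX_ne_zero β K)
  refine vars_subset_of_eval_indicator (s := Prod.fst ⁻¹' Set.range e) hframe (fun x hx => ?_) hp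
  let A : Matrix ι β K := of fun k q => x (k, q)
  have hA : IsUnit (A.submatrix e id).det := by
    rw [isUnit_iff_ne_zero]
    rwa [eval_rename, eval_det_mvPolynomialX] at hx
  obtain ⟨D, hD, hAD⟩ := exists_shear_eq_indicator hA
  exact (congr_arg (eval · f) hAD.symm).trans (hf A D hD)

end Shear

section TensorAction

open MvPolynomial

variable {m n : ℕ}

/-- The weight `k + i + j` of the variable `x_{ij}^{(k)}`, for which upper unipotent substitutions
change every variable only by terms of lower weight. -/
def indexSum (p : TensorIndex m n) : ℕ := p.1 + p.2.1 + p.2.2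

lemma tensorSubst_torusElem_X (t₁ : Fin m → ℂˣ) (t₂ t₃ : Fin n → ℂˣ) (p : TensorIndex m n) :
    tensorSubst (torusElem t₁, torusElem t₂, torusElem t₃) (X p) =
      ((t₁ p.1 * t₂ p.2.1 * t₃ p.2.2 : ℂˣ) : ℂ) • X p := by
  simp [tensorSubst_X, torusElem, diagonal_apply, Fintype.sum_prod_type, smul_eq_C_mul, apply_ite,
    ite_mul]

lemma tensorSubst_fst_X (u : GL (Fin m) ℂ) (p : TensorIndex m n) :
    tensorSubst (u, 1, 1) (X p) = ∑ k, u.1 k p.1 • X (k, p.2) := by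
  simp [tensorSubst_X, one_apply, Fintype.sum_prod_type, smul_eq_C_mul, apply_ite, ite_mul]

lemma tensorSubst_X_sub_mem_weightLT {u₁ : GL (Fin m) ℂ} {u₂ u₃ : GL (Fin n) ℂ}
    (h₁ : IsUpperUnipotent u₁) (h₂ : IsUpperUnipotent u₂) (h₃ : IsUpperUnipotent u₃)
    (p : TensorIndex m n) :
    tensorSubst (u₁, u₂, u₃) (X p) - X p ∈ weightLT ℂ indexSum (indexSum p) := by
  rw [tensorSubst_X, ← Finset.sum_erase_add _ _ (Finset.mem_univ p)]
  simp only [h₁.2, h₂.2, h₃.2, mul_one, map_one, one_mul, add_sub_cancel_right]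
  refine sum_mem fun q hq => ?_
  rw [C_mul_X_eq_monomial, weightLT, monomial_mem_restrictSupport, or_iff_not_imp_right]
  intro hcoeff
  have hle : q.1 ≤ p.1 ∧ q.2.1 ≤ p.2.1 ∧ q.2.2 ≤ p.2.2 := by
    refine ⟨?_, ?_, ?_⟩ <;> by_contra! hlt
    · simp [h₁.1 _ _ hlt] at hcoeff
    · simp [h₂.1 _ _ hlt] at hcoeff
    · simp [h₃.1 _ _ hlt] at hcoeff
  have hne := Finset.ne_of_mem_erase hq
  simp only [ne_eq, Prod.ext_iff, Fin.ext_iff, Fin.le_def] at hle hne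
  simp only [indexSum, Set.mem_ofPred_eq, Finsupp.weight_single, one_smul]
  omega

lemma isUpperUnipotent_one {r : ℕ} : IsUpperUnipotent (1 : GL (Fin r) ℂ) :=
  ⟨fun _ _ h => one_apply_ne h.ne', fun _ => one_apply_eq _⟩

lemma torusElem_one {r : ℕ} : torusElem (1 : Fin r → ℂˣ) = 1 := by
  ext i j
  simp [torusElem]

lemma prod_pow_comp_eq_torusChar {σ : Type*} {r : ℕ} (π : σ → Fin r) (t : Fin r → ℂˣ)
    (s : σ →₀ ℕ) :
    (s.prod fun p e => t (π p) ^ e) = torusChar (fun k => (s.mapDomain π k : ℤ)) t := by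
  simp only [torusChar, zpow_natCast]
  rw [← Finsupp.prod_fintype _ _ fun _ => pow_zero _,
    Finsupp.prod_mapDomain_index (by simp) fun _ _ _ => pow_add _ _ _]

theorem exists_isTensorHighestWeightVector {V : Subrepresentation (tensorRep m n)} (hV : V ≠ ⊥) :
    ∃ f ∈ V, ∃ w₁ w₂ w₃, IsTensorHighestWeightVector (tensorRep m n) w₁ w₂ w₃ f := by
  obtain ⟨f, hfV, hf0, ⟨s, hs⟩, hfix⟩ := exists_weightVector_fixed indexSum
    (V := V.toSubmodule) (fun h => hV (Subrepresentation.toSubmodule_injective h))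
  refine ⟨f, hfV, fun k => s.mapDomain (·.1) k, fun i => s.mapDomain (·.2.1) i,
    fun j => s.mapDomain (·.2.2) j, hf0, fun t₁ t₂ t₃ => ?_, fun u₁ u₂ u₃ h₁ h₂ h₃ => ?_⟩
  · refine (hs _ _ (tensorSubst_torusElem_X t₁ t₂ t₃) (V.apply_mem_toSubmodule _)).trans ?_
    simp only [← prod_pow_comp_eq_torusChar, ← Finsupp.prod_mul, ← mul_pow]
    congr 1
    simp [Finsupp.prod]
  · exact hfix _ (tensorSubst_X_sub_mem_weightLT h₁ h₂ h₃) (V.apply_mem_toSubmodule _)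

theorem exists_isHighestWeightVector {V : Subrepresentation (tensorRepGLm m n)} (hV : V ≠ ⊥) :
    ∃ f ∈ V, ∃ w, IsHighestWeightVector (tensorRepGLm m n) w f := by
  obtain ⟨f, hfV, hf0, ⟨s, hs⟩, hfix⟩ := exists_weightVector_fixed indexSum
    (V := V.toSubmodule) (fun h => hV (Subrepresentation.toSubmodule_injective h))
  refine ⟨f, hfV, fun k => s.mapDomain (·.1) k, hf0, fun t => ?_, fun u hu => ?_⟩
  · have hX := tensorSubst_torusElem_X (n := n) t 1 1
    rw [torusElem_one] at hX
    refine (hs _ _ hX (V.apply_mem_toSubmodule _)).trans ?_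
    rw [← prod_pow_comp_eq_torusChar]
    simp [Finsupp.prod]
  · exact hfix _ (tensorSubst_X_sub_mem_weightLT hu isUpperUnipotent_one isUpperUnipotent_one)
      (V.apply_mem_toSubmodule _)

lemma ne_bot_of_isIrreducible {k G M : Type*} [Field k] [Monoid G] [AddCommGroup M] [Module k M]
    {ρ : Representation k G M} {V : Subrepresentation ρ} (hV : V.toRepresentation.IsIrreducible) :
    V ≠ ⊥ := by
  rintro rfl
  obtain ⟨W₁, W₂, hne⟩ := hV.exists_pair_ne
  have : Subsingleton (⊥ : Subrepresentation ρ).toSubmodule :=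
    inferInstanceAs (Subsingleton (⊥ : Submodule k M))
  exact hne (Subrepresentation.toSubmodule_injective (Subsingleton.elim _ _))

end TensorAction

section Truncation

open MvPolynomial

variable {m n : ℕ}

lemma exists_isUpperUnipotent_of_eq {r : ℕ} {M : Matrix (Fin r) (Fin r) ℂ}
    (hM : M.IsUpperTriangular) (hdiag : ∀ i, M i i = 1) :
    ∃ u : GL (Fin r) ℂ, IsUpperUnipotent u ∧ u.1 = M := by
  have hdet : M.det ≠ 0 := by simp [det_of_isUpperTriangular hM, hdiag]
  exact ⟨GeneralLinearGroup.mkOfDetNeZero M hdet, ⟨fun i j h => hM h, hdiag⟩, rfl⟩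

lemma exists_isUpperUnipotent_shear {r : ℕ} {β : Type*} [Fintype β] {e : β → Fin r}
    (he : IsLowerSet (Set.range e)) {D : Matrix (Fin r) β ℂ} (hD : ∀ b, D (e b) = 0) :
    ∃ u : GL (Fin r) ℂ, IsUpperUnipotent u ∧
      ∀ A : Matrix (Fin r) β ℂ, u.valᵀ * A = A - D * A.submatrix e id := by
  let P : Matrix β (Fin r) ℂ := submatrix 1 e id
  have hDP {k l : Fin r} (hlk : k ≤ l) : (D * P) k l = 0 := by
    refine Finset.sum_eq_zero fun b _ => ?_
    rcases eq_or_ne (e b) l with rfl | hbl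
    · obtain ⟨b', rfl⟩ := he hlk ⟨b, rfl⟩
      simp [hD]
    · exact mul_eq_zero_of_right _ (one_apply_ne hbl)
  obtain ⟨u, hu, hu'⟩ := exists_isUpperUnipotent_of_eq (M := (1 - D * P)ᵀ)
    (fun i j (h : j < i) => by simp [hDP h.le, one_apply_ne h.ne]) (fun i => by simp [hDP])
  refine ⟨u, hu, fun A => ?_⟩
  have hP : P * A = A.submatrix e id := one_submatrix_mul e (Equiv.refl _) A
  rw [hu', transpose_transpose, Matrix.sub_mul, Matrix.one_mul, Matrix.mul_assoc, hP]

lemma eval_tensorSubst_fst (u : GL (Fin m) ℂ) (A : Matrix (Fin m) (Fin n × Fin n) ℂ)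
    (f : TensorPoly m n) :
    eval (fun p => A p.1 p.2) (tensorSubst (u, 1, 1) f) =
      eval (fun p => (u.valᵀ * A) p.1 p.2) f := by
  have h : (aeval fun p => A p.1 p.2).comp (tensorSubst (u, 1, 1)) =
      (aeval fun p => (u.valᵀ * A) p.1 p.2 : TensorPoly m n →ₐ[ℂ] ℂ) :=
    algHom_ext fun p => by simp [tensorSubst_fst_X, Matrix.mul_apply, smul_eval]
  exact DFunLike.congr_fun h f

theorem val_lt_of_mem_vars_of_unipotent_invariant (hm : n ^ 2 ≤ m) {f : TensorPoly m n}
    (hf : ∀ u : GL (Fin m) ℂ, IsUpperUnipotent u → tensorSubst (u, 1, 1) f = f)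
    {p : TensorIndex m n} (hp : p ∈ f.vars) : (p.1 : ℕ) < n ^ 2 := by
  let e : Fin n × Fin n → Fin m := Fin.castLE (by rwa [← sq]) ∘ finProdFinEquiv
  have hrange : Set.range e = {k : Fin m | (k : ℕ) < n ^ 2} := by
    rw [EquivLike.range_comp, Fin.range_castLE, ← sq]
  have hlower : IsLowerSet (Set.range e) := by
    rw [hrange]
    exact fun _ _ hle hlt => (Fin.le_def.mp hle).trans_lt hlt
  have hinj : Function.Injective e := (Fin.castLE_injective _).comp finProdFinEquiv.injective
  suffices p.1 ∈ Set.range e by rwa [hrange] at this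
  refine fst_mem_range_of_mem_vars_of_shear_invariant hinj (fun A D hD => ?_) hp
  obtain ⟨u, hu, huA⟩ := exists_isUpperUnipotent_shear hlower hD
  rw [← huA, ← eval_tensorSubst_fst, hf u hu]

lemma extend_zero_mem_Sing {m' : ℕ} (h : m' ≤ m) {B : TensorIndex m' n → ℂ}
    (hB : B ∈ Sing n m') : Function.extend (Prod.map (Fin.castLE h) id) B 0 ∈ Sing n m := by
  have hinj : Function.Injective (Prod.map (Fin.castLE h) (id : Fin n × Fin n → _)) :=
    (Fin.castLE_injective h).prodMap Function.injective_id
  intro c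
  rw [← hB fun k => c (Fin.castLE h k)]
  congr 1
  refine (Fintype.sum_of_injective (Fin.castLE h) (Fin.castLE_injective h) _ _ ?_ ?_).symm
  · intro k hk
    ext i j
    have hB0 : Function.extend (Prod.map (Fin.castLE h) id) B 0 (k, i, j) = 0 :=
      Function.extend_apply' _ _ _ fun ⟨p, hp⟩ => hk ⟨p.1, congr_arg Prod.fst hp⟩
    simp [slice, hB0]
  · intro k
    ext i j
    have := hinj.extend_apply B 0 (k, i, j)
    simp_all [slice]

theorem exists_mem_singIdeal_tensorIncl_eq {m' : ℕ} (h : m' ≤ m) {f : TensorPoly m n}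
    (hf : f ∈ singIdeal n m) (hvars : ∀ p ∈ f.vars, (p.1 : ℕ) < m') :
    ∃ g ∈ singIdeal n m', tensorIncl n h g = f := by
  have hinj : Function.Injective (Prod.map (Fin.castLE h) (id : Fin n × Fin n → _)) :=
    (Fin.castLE_injective h).prodMap Function.injective_id
  obtain ⟨g, rfl⟩ := exists_rename_eq_of_vars_subset_range f _ hinj
    fun p hp => ⟨(⟨p.1, hvars p hp⟩, p.2), rfl⟩
  refine ⟨g, (mem_vanishingIdeal_iff ..).mpr fun B hB => ?_, rfl⟩
  have h0 := (mem_vanishingIdeal_iff ..).mp hf _ (extend_zero_mem_Sing h hB)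
  rwa [aeval_rename, Function.extend_comp hinj] at h0

end Truncation

theorem theorem4p4_general (n m : ℕ) (hm : n ^ 2 ≤ m) :
    (∀ V : Subrepresentation (tensorRep m n), V ≠ ⊥ →
      ∃ f ∈ V, ∃ w₁ w₂ w₃, IsTensorHighestWeightVector (tensorRep m n) w₁ w₂ w₃ f) ∧
    (∀ f ∈ singIdeal n m, ∀ w₁ w₂ w₃, IsTensorHighestWeightVector (tensorRep m n) w₁ w₂ w₃ f →
      (∃ h ∈ singIdeal n (n ^ 2), tensorIncl n hm h = f) ∧ ∀ p ∈ f.vars, (p.1 : ℕ) < n ^ 2) ∧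
    (∀ V : Subrepresentation (tensorRepGLm m n), V ≠ ⊥ →
      ∃ f ∈ V, ∃ w, IsHighestWeightVector (tensorRepGLm m n) w f) ∧
    (∀ f ∈ singIdeal n m, ∀ w, IsHighestWeightVector (tensorRepGLm m n) w f →
      (∃ h ∈ singIdeal n (n ^ 2), tensorIncl n hm h = f) ∧ ∀ p ∈ f.vars, (p.1 : ℕ) < n ^ 2) := by
  have descend {f : TensorPoly m n} (hf : f ∈ singIdeal n m)
      (hfix : ∀ u : GL (Fin m) ℂ, IsUpperUnipotent u → tensorSubst (u, 1, 1) f = f) :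
      (∃ h ∈ singIdeal n (n ^ 2), tensorIncl n hm h = f) ∧ ∀ p ∈ f.vars, (p.1 : ℕ) < n ^ 2 :=
    have hvars p (hp : p ∈ f.vars) := val_lt_of_mem_vars_of_unipotent_invariant hm hfix hp
    ⟨exists_mem_singIdeal_tensorIncl_eq hm hf hvars, hvars⟩
  exact ⟨fun _ => exists_isTensorHighestWeightVector,
    fun f hf _ _ _ hw => descend hf fun u hu =>
      hw.unipotent u 1 1 hu isUpperUnipotent_one isUpperUnipotent_one,
    fun _ => exists_isHighestWeightVector,
    fun f hf _ hw => descend hf hw.unipotent⟩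

theorem theorem4p4 (n m : ℕ) (hm : n ^ 2 < m) :
    -- irreducible subrepresentations for `GL_m × GL_n × GL_n`
    (∀ V : Subrepresentation (tensorRep m n),
      V.toRepresentation.IsIrreducible →
      (∀ f ∈ V, f ∈ singIdeal n m) →
      (∃ f ∈ V, ∃ w₁ w₂ w₃, IsTensorHighestWeightVector (tensorRep m n) w₁ w₂ w₃ f) ∧
      ∀ f ∈ V, ∀ w₁ w₂ w₃, IsTensorHighestWeightVector (tensorRep m n) w₁ w₂ w₃ f →
        (∃ h ∈ singIdeal n (n ^ 2), tensorIncl n hm.le h = f) ∧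
        ∀ p ∈ f.vars, (p.1 : ℕ) < n ^ 2) ∧
    -- irreducible subrepresentations for `GL_m`
    (∀ V : Subrepresentation (tensorRepGLm m n),
      V.toRepresentation.IsIrreducible →
      (∀ f ∈ V, f ∈ singIdeal n m) →
      (∃ f ∈ V, ∃ w, IsHighestWeightVector (tensorRepGLm m n) w f) ∧
      ∀ f ∈ V, ∀ w, IsHighestWeightVector (tensorRepGLm m n) w f →
        (∃ h ∈ singIdeal n (n ^ 2), tensorIncl n hm.le h = f) ∧
        ∀ p ∈ f.vars, (p.1 : ℕ) < n ^ 2) := by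
  obtain ⟨hex, hdesc, hexGL, hdescGL⟩ := theorem4p4_general n m hm.le
  exact ⟨fun V hV hI => ⟨hex V (ne_bot_of_isIrreducible hV), fun f hf => hdesc f (hI f hf)⟩,
    fun V hV hI => ⟨hexGL V (ne_bot_of_isIrreducible hV), fun f hf => hdescGL f (hI f hf)⟩⟩
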